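/- Let $d\ge 2$ and $0<r\le \pi/2$. Let $\mathbb S^d$ be the unit sphere of $\mathbb E^{d+1}$ with spherical (angular) distance ${\rm dist}_s$, let ${\bf B}[{\bf x},\rho]=\{{\bf y}\in\mathbb S^d : {\rm dist}_s({\bf x},{\bf y})\le\rho\}$, and for $X\subseteq\mathbb S^d$ put ${\bf B}[X,r]=\bigcap_{{\bf x}\in X}{\bf B}[{\bf x},r]$. A wide $r$-ball body is a set ${\bf B}[X,r]$, where $X\subseteq\mathbb S^d$ is nonempty and closed and any two of its points have spherical distance at most $r$. A closed hemisphere ${\bf B}[{\bf x},\pi/2]$ is a supporting hemisphere of ${\bf K}\subseteq\mathbb S^d$ if it contains ${\bf K}$ and its boundary meets ${\bf K}$. A lune is the intersection of two distinct closed hemispheres that are not opposite; its width is the spherical distance of the centers of the two $(d-1)$-dimensional hemispheres that bound it. For a supporting hemisphere ${\bf H}$ of ${\bf K}$ let ${\rm width}_{\bf H}({\bf K})$ be the minimum of the widths of the lunes ${\bf H}\cap{\bf H}'$, where ${\bf H}'$ is a supporting hemisphere of ${\bf K}$ (different from ${\bf H}$ and not opposite to it), and let the minimal spherical width ${\rm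 width}_s({\bf K})$ be the minimum of ${\rm width}_{\bf H}({\bf K})$ over all supporting hemispheres ${\bf H}$ of ${\bf K}$. Regular spherical $d$-simplices of edge length $r$ exist in $\mathbb S^d$. Let ${\bf \Delta}_d(r)$ be the intersection of the $d+1$ closed balls of radius $r$ centered at the vertices of any such simplex. Then ${\bf \Delta}_d(r)$ is a wide $r$-ball body different from a closed hemisphere, and for every wide $r$-ball body ${\bf K}$ that is not a closed hemisphere (only $r=\pi/2$ with a one-point $X$ gives a closed hemisphere) all the minima in the definition of ${\rm width}_s({\bf K})$ exist and $${\rm width}_s({\bf K})\ \ge\ {\rm width}_s({\bf \Delta}_d(r))\ =\ r .$$ -/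

import Mathlib

open scoped RealInnerProductSpace

noncomputable section

namespace SphericalWidth

/-- The unit sphere `𝕊^d` centered at the origin of `(d+1)`-dimensional Euclidean space. -/
abbrev Sph (d : ℕ) : Type :=
  Metric.sphere (0 : EuclideanSpace ℝ (Fin (d + 1))) 1

/-- Spherical distance: the length of the shorter great circular arc from `x` to `y`
(and `π` for antipodes), that is, the angle between the unit vectors `x` and `y`. -/
def sdist {d : ℕ} (x y : Sph d) : ℝ :=
  InnerProductGeometry.angle (x : EuclideanSpace ℝ (Fin (d + 1))) y

/-- The closed spherical ball of center `x` and radius `r`. -/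
def sBall {d : ℕ} (x : Sph d) (r : ℝ) : Set (Sph d) :=
  {y | sdist x y ≤ r}

/-- The intersection of the closed balls of radius `r` centered at the points of `X`. -/
def ballInter {d : ℕ} (X : Set (Sph d)) (r : ℝ) : Set (Sph d) :=
  ⋂ x ∈ X, sBall x r

/-- The closed hemisphere with center `x`. -/
def hemisphere {d : ℕ} (x : Sph d) : Set (Sph d) :=
  sBall x (Real.pi / 2)

/-- The `(d-1)`-dimensional great sphere bounding the closed hemisphere with center `x`. -/
def greatSphere {d : ℕ} (x : Sph d) : Set (Sph d) :=
  {y | sdist x y = Real.pi / 2}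

/-- Spherical diameter. All the distances lie in `[0, π]`, so the supremum is a genuine one for
every nonempty set. -/
def sdiam {d : ℕ} (Q : Set (Sph d)) : ℝ :=
  sSup {t | ∃ x ∈ Q, ∃ y ∈ Q, t = sdist x y}

/-- `K` is a wide `r`-ball body: the intersection of the closed balls of radius `r` centered at the
points of a nonempty closed set of spherical diameter at most `r`. -/
def IsWideBallBody {d : ℕ} (r : ℝ) (K : Set (Sph d)) : Prop :=
  ∃ X : Set (Sph d), X.Nonempty ∧ IsClosed X ∧ sdiam X ≤ r ∧ K = ballInter X r

/-- The points `v 0, …, v d` are the vertices of a regular spherical `d`-simplex of edge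
length `r`. -/
def IsRegularSimplex {d : ℕ} (r : ℝ) (v : Fin (d + 1) → Sph d) : Prop :=
  ∀ i j, i ≠ j → sdist (v i) (v j) = r

/-- The closed hemisphere with center `x` is a closed supporting hemisphere of `K`. -/
def IsSupporting {d : ℕ} (K : Set (Sph d)) (x : Sph d) : Prop :=
  (greatSphere x ∩ K).Nonempty ∧ K ⊆ hemisphere x

/-- The closed hemispheres with centers `x` and `y` are distinct and not opposite, so that their
intersection is a lune. -/
def FormLune {d : ℕ} (x y : Sph d) : Prop :=
  x ≠ y ∧ x ≠ -y

/-- The component of `y` orthogonal to `x`. If `x` and `y` form a lune, it is a positive multiple of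
the center of the `(d-1)`-dimensional hemisphere `greatSphere x ∩ hemisphere y`. -/
def faceDir {d : ℕ} (x y : Sph d) : EuclideanSpace ℝ (Fin (d + 1)) :=
  (y : EuclideanSpace ℝ (Fin (d + 1))) -
    ⟪(x : EuclideanSpace ℝ (Fin (d + 1))), (y : EuclideanSpace ℝ (Fin (d + 1)))⟫ •
      (x : EuclideanSpace ℝ (Fin (d + 1)))

/-- The spherical width of the lune `hemisphere x ∩ hemisphere y`: the spherical distance of the
centers of the two `(d-1)`-dimensional hemispheres bounding it (the angle does not depend on the
lengths of the two vectors). -/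
def luneWidth {d : ℕ} (x y : Sph d) : ℝ :=
  InnerProductGeometry.angle (faceDir x y) (faceDir y x)

/-- The widths of the lunes cut out by the supporting hemisphere of `K` with center `x` and the
other supporting hemispheres of `K`. -/
def luneWidths {d : ℕ} (K : Set (Sph d)) (x : Sph d) : Set ℝ :=
  {w | ∃ y, IsSupporting K y ∧ FormLune x y ∧ w = luneWidth x y}

/-- The width of `K` determined by its supporting hemisphere with center `x`. -/
def widthAt {d : ℕ} (K : Set (Sph d)) (x : Sph d) : ℝ :=
  sInf (luneWidths K x)

/-- The widths of `K` determined by all its supporting hemispheres. -/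
def widths {d : ℕ} (K : Set (Sph d)) : Set ℝ :=
  {w | ∃ x, IsSupporting K x ∧ w = widthAt K x}

/-- The minimal spherical width (thickness) of `K`. -/
def minWidth {d : ℕ} (K : Set (Sph d)) : ℝ :=
  sInf (widths K)

end SphericalWidth

end

open SphericalWidth

namespace SphericalWidth

/-! A lune has width `π` minus the distance of the centers of its two hemispheres, so the bound `r ≤
width` says that any two centers `x`, `y` of supporting hemispheres satisfy `sdist x y ≤ π - r`.

Let the hemisphere of `x` touch `K = ballInter X r` at `k`, and let `z = cos r • k + sin r • x` be
the center of the ball of radius `r` that touches it from inside at `k`. The body lies in that ball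
(`cos_le_inner_of_isSupporting`). As `X` has diameter at most `r`, it is contained in `K`; hence `z`
is within `r` of all of `X`, that is, `z ∈ K`. So `z` lies in the hemisphere of `y`, and the
triangle inequality through `z` gives `(π/2 - r) + π/2` (`sdist_le_of_isSupporting`).

For the simplex, two hemispheres touching the body at two vertices attain the bound. The minima
exist because the supporting centers form a compact set, which has at least two points unless `K` is
a hemisphere. -/

variable {d : ℕ}

/-! ### Spherical distances in terms of inner products -/

@[simp] lemma norm_coe (x : Sph d) : ‖(x : EuclideanSpace ℝ (Fin (d + 1)))‖ = 1 := by
  simp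

@[simp] lemma inner_self_coe (x : Sph d) :
    inner ℝ (x : EuclideanSpace ℝ (Fin (d + 1))) (x : EuclideanSpace ℝ (Fin (d + 1))) = 1 := by
  rw [real_inner_self_eq_norm_sq, norm_coe]; norm_num

lemma inner_le_one (x y : Sph d) : inner ℝ x.1 y.1 ≤ 1 := by
  simpa using real_inner_le_norm x.1 y.1

lemma neg_one_le_inner (x y : Sph d) : -1 ≤ inner ℝ x.1 y.1 := by
  simpa using (abs_le.1 (abs_real_inner_le_norm x.1 y.1)).1

lemma sdist_eq (x y : Sph d) : sdist x y = Real.arccos (inner ℝ x.1 y.1) := by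
  simp [sdist, InnerProductGeometry.angle]

lemma cos_sdist (x y : Sph d) : Real.cos (sdist x y) = inner ℝ x.1 y.1 := by
  rw [sdist_eq, Real.cos_arccos (neg_one_le_inner x y) (inner_le_one x y)]

lemma sdist_nonneg (x y : Sph d) : 0 ≤ sdist x y := InnerProductGeometry.angle_nonneg _ _

lemma sdist_le_pi (x y : Sph d) : sdist x y ≤ Real.pi := InnerProductGeometry.angle_le_pi _ _

lemma sdist_le_iff {x y : Sph d} {r : ℝ} (h0 : 0 ≤ r) (h1 : r ≤ Real.pi) :
    sdist x y ≤ r ↔ Real.cos r ≤ inner ℝ x.1 y.1 := by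
  rw [← cos_sdist]
  exact (Real.strictAntiOn_cos.le_iff_ge ⟨h0, h1⟩ ⟨sdist_nonneg x y, sdist_le_pi x y⟩).symm

lemma sdist_eq_iff {x y : Sph d} {r : ℝ} (h0 : 0 ≤ r) (h1 : r ≤ Real.pi) :
    sdist x y = r ↔ inner ℝ x.1 y.1 = Real.cos r := by
  rw [← cos_sdist]
  exact (Real.injOn_cos.eq_iff ⟨sdist_nonneg x y, sdist_le_pi x y⟩ ⟨h0, h1⟩).symm

lemma mem_ballInter {X : Set (Sph d)} {r : ℝ} (h0 : 0 ≤ r) (h1 : r ≤ Real.pi) {y : Sph d} :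
    y ∈ ballInter X r ↔ ∀ u ∈ X, Real.cos r ≤ inner ℝ u.1 y.1 := by
  simp only [ballInter, sBall, Set.mem_iInter, Set.mem_ofPred_eq, sdist_le_iff h0 h1]

lemma mem_hemisphere {x y : Sph d} : y ∈ hemisphere x ↔ 0 ≤ inner ℝ x.1 y.1 := by
  have := Real.pi_pos
  simp only [hemisphere, sBall, Set.mem_ofPred_eq]
  rw [sdist_le_iff (by linarith) (by linarith), Real.cos_pi_div_two]

lemma mem_greatSphere {x y : Sph d} : y ∈ greatSphere x ↔ inner ℝ x.1 y.1 = 0 := by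
  have := Real.pi_pos
  simp only [greatSphere, Set.mem_ofPred_eq]
  rw [sdist_eq_iff (by linarith) (by linarith), Real.cos_pi_div_two]

lemma isSupporting_iff {K : Set (Sph d)} {x : Sph d} :
    IsSupporting K x ↔
      (∃ k ∈ K, inner ℝ x.1 k.1 = 0) ∧ ∀ k ∈ K, 0 ≤ inner ℝ x.1 k.1 := by
  refine and_congr ⟨?_, ?_⟩ ?_
  · rintro ⟨k, h, hk⟩; exact ⟨k, hk, mem_greatSphere.1 h⟩
  · rintro ⟨k, hk, h⟩; exact ⟨k, mem_greatSphere.2 h, hk⟩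
  · exact forall₂_congr fun k _ => mem_hemisphere

lemma sdist_self (x : Sph d) : sdist x x = 0 := by simp [sdist_eq]

lemma eq_of_inner_eq_one {x y : Sph d} (h : inner ℝ x.1 y.1 = 1) : x = y :=
  Subtype.ext ((inner_eq_one_iff_of_norm_eq_one (𝕜 := ℝ) (norm_coe x) (norm_coe y)).1 h)

lemma eq_neg_of_inner_eq_neg_one {x y : Sph d} (h : inner ℝ x.1 y.1 = -1) : x = -y := by
  apply eq_of_inner_eq_one
  simp [inner_neg_right, h]

/-- The width of a lune is the supplement of the distance between the centers of the
hemispheres that bound it. -/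
lemma luneWidth_eq {x y : Sph d} (h : FormLune x y) : luneWidth x y = Real.pi - sdist x y := by
  set a : ℝ := inner ℝ x.1 y.1 with ha
  have hyx : inner ℝ y.1 x.1 = a := real_inner_comm _ _
  have h1 : a < 1 := lt_of_le_of_ne (inner_le_one x y) fun e => h.1 (eq_of_inner_eq_one e)
  have h2 : -1 < a := lt_of_le_of_ne (neg_one_le_inner x y)
    fun e => h.2 (eq_neg_of_inner_eq_neg_one e.symm)
  have hpos : 0 < 1 - a ^ 2 := by nlinarith
  have hn : ∀ p q : Sph d, inner ℝ p.1 q.1 = a → ‖faceDir p q‖ ^ 2 = 1 - a ^ 2 := by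
    intro p q hpq
    have hqp : inner ℝ q.1 p.1 = a := by rw [real_inner_comm, hpq]
    rw [← real_inner_self_eq_norm_sq]
    simp only [faceDir, inner_sub_left, inner_sub_right, inner_smul_left, inner_smul_right,
      inner_self_coe, hpq, hqp, conj_trivial]
    ring
  have hi : inner ℝ (faceDir x y) (faceDir y x) = -a * (1 - a ^ 2) := by
    simp only [faceDir, inner_sub_left, inner_sub_right, inner_smul_left, inner_smul_right,
      inner_self_coe, hyx, ← ha, conj_trivial]
    ring
  have hnn : ‖faceDir x y‖ * ‖faceDir y x‖ = 1 - a ^ 2 := by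
    rw [show ‖faceDir y x‖ = ‖faceDir x y‖ from
      (sq_eq_sq₀ (norm_nonneg _) (norm_nonneg _)).1 ((hn y x hyx).trans (hn x y rfl).symm),
      ← sq, hn x y rfl]
  rw [luneWidth, InnerProductGeometry.angle, hi, hnn, mul_div_assoc, div_self hpos.ne', mul_one,
    Real.arccos_neg, sdist_eq]

/-! ### The touching ball and the bound on distances of supporting centers -/

/-- If the hemisphere with center `x` supports `ballInter X r` at `k`, then the body lies in the ball
of radius `r` that touches this hemisphere from inside at `k`. -/
lemma cos_le_inner_of_isSupporting {X : Set (Sph d)} {r : ℝ} (hr0 : 0 ≤ r) (hr : r ≤ Real.pi / 2)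
    {x k y : Sph d} (hx : ∀ m ∈ ballInter X r, 0 ≤ inner ℝ x.1 m.1)
    (hk : k ∈ ballInter X r) (hxk : inner ℝ x.1 k.1 = 0) (hy : y ∈ ballInter X r) :
    Real.cos r ≤ inner ℝ (Real.cos r • k.1 + Real.sin r • x.1) y.1 := by
  have hpi := Real.pi_pos
  have hc0 : 0 ≤ Real.cos r := Real.cos_nonneg_of_neg_pi_div_two_le_of_le (by linarith) hr
  have hs0 : 0 ≤ Real.sin r := Real.sin_nonneg_of_nonneg_of_le_pi hr0 (by linarith)
  have hcs := Real.sin_sq_add_cos_sq r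
  have hmem := fun y => mem_ballInter (X := X) (y := y) hr0 (by linarith)
  set c := Real.cos r
  set s := Real.sin r
  rw [inner_add_left, real_inner_smul_left, real_inner_smul_left]
  set p : ℝ := inner ℝ k.1 y.1 with hp
  set q : ℝ := inner ℝ x.1 y.1 with hq
  have hq0 : 0 ≤ q := hx y hy
  by_contra! hlt
  have hp1 : p ≤ 1 := inner_le_one k y
  -- Subtracting `η • x` with `η > q` pushes `y` strictly out of the hemisphere. The strict
  -- inequality `hlt` leaves room to do so with `y - η • x` still outside the touching ball to first
  -- order; the aim is a point of the body near `k` outside the hemisphere.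
  obtain ⟨η, hη1, hη2⟩ : ∃ η, q < η ∧ s * η < c * (1 - p) := by
    rcases hs0.eq_or_lt with h | h
    · exact ⟨q + 1, by linarith, by rw [← h] at hlt ⊢; nlinarith⟩
    · obtain ⟨η, h1, h2⟩ := exists_between (show q < c * (1 - p) / s by
        rw [lt_div_iff₀ h]; linarith)
      exact ⟨η, h1, by rw [lt_div_iff₀ h] at h2; linarith⟩
  set v : EuclideanSpace ℝ (Fin (d + 1)) := y.1 - η • x.1 with hv
  have hkx : inner ℝ k.1 x.1 = 0 := by rw [real_inner_comm, hxk]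
  have hkv : inner ℝ k.1 v = p := by
    rw [hv, inner_sub_right, real_inner_smul_right, hkx]; simp [hp]
  have hxv : inner ℝ x.1 v = q - η := by
    rw [hv, inner_sub_right, real_inner_smul_right]; simp [hq]
  set δ := c * (1 - p) - s * η with hδ
  have hδ0 : 0 < δ := by linarith
  -- Small enough for the first-order gain `t * δ` to absorb the quadratic term of `‖k + t • v‖`;
  -- the `+ 1` only keeps the denominator positive.
  obtain ⟨t, ht0, ht⟩ : ∃ t : ℝ, 0 < t ∧ c * (t * ‖v‖ ^ 2 / 2) ≤ δ := by
    have hB : 0 < c * (‖v‖ ^ 2 / 2) + 1 := by positivity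
    refine ⟨δ / (c * (‖v‖ ^ 2 / 2) + 1), by positivity, ?_⟩
    have : c * (δ / (c * (‖v‖ ^ 2 / 2) + 1) * ‖v‖ ^ 2 / 2) =
      δ * ((c * (‖v‖ ^ 2 / 2)) / (c * (‖v‖ ^ 2 / 2) + 1)) := by ring
    rw [this]
    exact mul_le_of_le_one_right hδ0.le ((div_le_one hB).2 (by linarith))
  set w := k.1 + t • v with hw
  have hxw : inner ℝ x.1 w = t * (q - η) := by
    rw [hw, inner_add_right, real_inner_smul_right, hxk, hxv, zero_add]
  have hxw0 : inner ℝ x.1 w < 0 := by rw [hxw]; exact mul_neg_of_pos_of_neg ht0 (by linarith)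
  have hw0 : w ≠ 0 := fun h => by simp [h] at hxw0
  have hwn : ‖w‖ ≤ 1 + t * p + t ^ 2 * ‖v‖ ^ 2 / 2 := by
    have h1 : ‖w‖ ^ 2 = 1 + 2 * (t * p) + t ^ 2 * ‖v‖ ^ 2 := by
      rw [hw, norm_add_sq_real, norm_coe, real_inner_smul_right, hkv, norm_smul, mul_pow,
        Real.norm_eq_abs, sq_abs]; ring
    nlinarith [sq_nonneg (‖w‖ - 1)]
  have hwpos : 0 < ‖w‖ := norm_pos_iff.2 hw0
  let m : Sph d := ⟨‖w‖⁻¹ • w, by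
    simp [norm_smul, hwpos.ne']⟩
  have hm : m ∈ ballInter X r := by
    rw [hmem]
    intro u hu
    have huk := (hmem k).1 hk u hu
    have huy := (hmem y).1 hy u hu
    -- Bessel's inequality for the orthonormal pair `k`, `x`, with `⟪u, k⟫ ≥ c`.
    have hux : inner ℝ u.1 x.1 ≤ s := by
      have hn : 0 ≤ ‖u.1 - (inner ℝ u.1 k.1 : ℝ) • k.1 - (inner ℝ u.1 x.1 : ℝ) • x.1‖ ^ 2 :=
        sq_nonneg _
      rw [← real_inner_self_eq_norm_sq] at hn
      simp only [inner_sub_left, inner_sub_right, real_inner_smul_left, real_inner_smul_right,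
        inner_self_coe, hxk, hkx, real_inner_comm u.1 k.1, real_inner_comm u.1 x.1] at hn
      exact abs_le_of_sq_le_sq' (by nlinarith) hs0 |>.2
    have h1 : inner ℝ u.1 w = inner ℝ u.1 k.1 + t * (inner ℝ u.1 y.1 - η * inner ℝ u.1 x.1) := by
      rw [hw, hv, inner_add_right, real_inner_smul_right, inner_sub_right, real_inner_smul_right]
    have h2 : c * ‖w‖ ≤ inner ℝ u.1 w := by
      rw [h1]
      have e1 : c * ‖w‖ ≤ c * (1 + t * p + t ^ 2 * ‖v‖ ^ 2 / 2) :=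
        mul_le_mul_of_nonneg_left hwn hc0
      have e2 : t * (c * (t * ‖v‖ ^ 2 / 2)) ≤ t * δ := mul_le_mul_of_nonneg_left ht ht0.le
      have e3 : η * inner ℝ u.1 x.1 ≤ η * s := mul_le_mul_of_nonneg_left hux (by linarith)
      have e4 : t * (c - η * s) ≤ t * (inner ℝ u.1 y.1 - η * inner ℝ u.1 x.1) :=
        mul_le_mul_of_nonneg_left (by linarith) ht0.le
      have e5 : t * δ = t * (c - η * s) - c * (t * p) := by rw [hδ]; ring
      nlinarith
    change c ≤ inner ℝ u.1 (‖w‖⁻¹ • w)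
    rw [real_inner_smul_right, inv_mul_eq_div, le_div_iff₀ hwpos]
    exact h2
  have h3 := hx m hm
  change 0 ≤ inner ℝ x.1 (‖w‖⁻¹ • w) at h3
  rw [real_inner_smul_right] at h3
  exact absurd h3 (not_le.2 (mul_neg_of_pos_of_neg (inv_pos.2 hwpos) hxw0))

lemma sdist_le_of_sdiam_le {X : Set (Sph d)} {r : ℝ} (h : sdiam X ≤ r) {x y : Sph d} (hx : x ∈ X)
    (hy : y ∈ X) : sdist x y ≤ r := by
  have hb : BddAbove {t | ∃ x ∈ X, ∃ y ∈ X, t = sdist x y} := by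
    refine ⟨Real.pi, ?_⟩
    rintro _ ⟨a, -, b, -, rfl⟩
    exact sdist_le_pi a b
  exact (le_csSup hb ⟨x, hx, y, hy, rfl⟩).trans h

lemma subset_ballInter {X : Set (Sph d)} {r : ℝ} (h : sdiam X ≤ r) : X ⊆ ballInter X r := by
  intro x hx
  simp only [ballInter, sBall, Set.mem_iInter, Set.mem_ofPred_eq]
  exact fun u hu => sdist_le_of_sdiam_le h hu hx

/-- The centers of two supporting hemispheres of a wide `r`-ball body have distance at most
`π - r`. -/
lemma sdist_le_of_isSupporting {K : Set (Sph d)} {r : ℝ} (hr0 : 0 ≤ r) (hr : r ≤ Real.pi / 2)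
    (hK : IsWideBallBody r K) {x y : Sph d} (hx : IsSupporting K x) (hy : IsSupporting K y) :
    sdist x y ≤ Real.pi - r := by
  obtain ⟨X, -, -, hd, rfl⟩ := hK
  rw [isSupporting_iff] at hx hy
  obtain ⟨⟨k, hk, hxk⟩, hx⟩ := hx
  have hpi := Real.pi_pos
  have hkx : inner ℝ k.1 x.1 = 0 := by rw [real_inner_comm, hxk]
  have hcs := Real.sin_sq_add_cos_sq r
  let z : Sph d := ⟨Real.cos r • k.1 + Real.sin r • x.1, by
    rw [mem_sphere_zero_iff_norm, ← sq_eq_sq₀ (norm_nonneg _) zero_le_one,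
      ← real_inner_self_eq_norm_sq]
    simp only [inner_add_left, inner_add_right, real_inner_smul_left, real_inner_smul_right,
      inner_self_coe, hkx, hxk]
    linarith⟩
  have hz : z ∈ ballInter X r := by
    rw [mem_ballInter hr0 (by linarith)]
    intro u hu
    rw [real_inner_comm]
    exact cos_le_inner_of_isSupporting hr0 hr hx hk hxk (subset_ballInter hd hu)
  -- `x`, `z`, `k` lie on one quarter circle, with `z` at distance `r` from `k`.
  have h1 : sdist x z ≤ Real.pi / 2 - r := by
    rw [sdist_le_iff (by linarith) (by linarith), Real.cos_pi_div_two_sub]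
    change _ ≤ inner ℝ x.1 (Real.cos r • k.1 + Real.sin r • x.1)
    rw [inner_add_right, real_inner_smul_right, real_inner_smul_right, hxk]
    simp
  have h2 : sdist z y ≤ Real.pi / 2 := by
    rw [sdist_le_iff (by linarith) (by linarith), Real.cos_pi_div_two, real_inner_comm]
    exact hy.2 z hz
  have h3 : sdist x y ≤ sdist x z + sdist z y :=
    InnerProductGeometry.angle_le_angle_add_angle _ _ _
  linarith

/-! ### Compactness of the set of supporting centers -/

lemma continuous_inner_coe :
    Continuous fun p : Sph d × Sph d => (inner ℝ p.1.1 p.2.1 : ℝ) := by fun_prop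

lemma continuous_sdist : Continuous fun p : Sph d × Sph d => sdist p.1 p.2 := by
  simp only [sdist_eq]
  exact Real.continuous_arccos.comp continuous_inner_coe

lemma continuous_sdist_right (x : Sph d) : Continuous fun y => sdist x y := by
  simp only [sdist_eq]
  exact Real.continuous_arccos.comp (by fun_prop)

lemma isClosed_ballInter (X : Set (Sph d)) (r : ℝ) : IsClosed (ballInter X r) := by
  refine isClosed_biInter fun x _ => ?_
  exact isClosed_le (continuous_sdist_right x) continuous_const

/-- Touching `K` is a projection of a compact set of pairs (center, contact point); containing `K`
is a closed condition. -/
lemma isCompact_setOf_isSupporting {K : Set (Sph d)} (hK : IsCompact K) :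
    IsCompact {x | IsSupporting K x} := by
  have h1 : IsCompact (Prod.fst '' {p : Sph d × Sph d | p.2 ∈ K ∧ inner ℝ p.1.1 p.2.1 = 0}) := by
    refine IsCompact.image (IsClosed.isCompact ?_) continuous_fst
    exact (hK.isClosed.preimage continuous_snd).inter
      (isClosed_eq continuous_inner_coe continuous_const)
  have h2 : IsClosed {x : Sph d | ∀ k ∈ K, 0 ≤ inner ℝ x.1 k.1} := by
    simp only [Set.ofPred_forall]
    exact isClosed_biInter fun k _ => isClosed_le continuous_const (by fun_prop)
  convert h1.inter_right h2 using 1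
  ext x
  simp only [Set.mem_ofPred_eq, isSupporting_iff, Set.mem_inter_iff, Set.mem_image, Prod.exists,
    exists_and_right, exists_eq_right]

/-! ### Existence of supporting hemispheres -/

/-- On the segment from a point of the dual cone of `K` to a point outside of it there is a point
on the boundary of the dual cone. -/
lemma exists_mem_segment_boundary {K : Set (Sph d)} (hK : IsCompact K) (hne : K.Nonempty)
    {a b : EuclideanSpace ℝ (Fin (d + 1))} (ha : ∀ k ∈ K, 0 ≤ inner ℝ a k.1)
    (hb : ∃ k ∈ K, inner ℝ b k.1 < 0) :
    ∃ t : ℝ, 0 ≤ t ∧ t < 1 ∧ (∀ k ∈ K, 0 ≤ inner ℝ ((1 - t) • a + t • b) k.1) ∧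
      ∃ k ∈ K, inner ℝ ((1 - t) • a + t • b) k.1 = 0 := by
  set g : ℝ → Sph d → ℝ := fun t k => inner ℝ ((1 - t) • a + t • b) k.1 with hg
  have hgc : Continuous fun p : ℝ × Sph d => g p.1 p.2 := by simp only [hg]; fun_prop
  set f : ℝ → ℝ := fun t => sInf (g t '' K) with hf
  have hfc : Continuous f := hK.continuous_sInf (by exact hgc)
  have hleast : ∀ t, IsLeast (g t '' K) (f t) := fun t =>
    (hK.image (hgc.comp (by fun_prop : Continuous fun k => (t, k)))).isLeast_sInf (hne.image _)
  have h0 : 0 ≤ f 0 := by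
    obtain ⟨k, hk, e⟩ := (hleast 0).1
    rw [← e]; simpa [hg] using ha k hk
  have h1 : f 1 < 0 := by
    obtain ⟨k, hk, e⟩ := hb
    exact lt_of_le_of_lt ((hleast 1).2 ⟨k, hk, rfl⟩) (by simpa [hg] using e)
  -- The minimum over `K` of the linear functional varies continuously along the segment and changes
  -- sign.
  obtain ⟨t, ht, e⟩ := intermediate_value_Icc' zero_le_one hfc.continuousOn ⟨h1.le, h0⟩
  refine ⟨t, ht.1, lt_of_le_of_ne ht.2 ?_, fun k hk => ?_, ?_⟩
  · rintro rfl; exact h1.ne e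
  · rw [← e]; exact (hleast t).2 ⟨k, hk, rfl⟩
  · rw [← e]; exact (hleast t).1

lemma exists_isSupporting_of_ne_zero {K : Set (Sph d)} {w : EuclideanSpace ℝ (Fin (d + 1))}
    (hw : w ≠ 0) (h : ∀ k ∈ K, 0 ≤ inner ℝ w k.1) (h0 : ∃ k ∈ K, inner ℝ w k.1 = 0) :
    ∃ x : Sph d, IsSupporting K x ∧ x.1 = ‖w‖⁻¹ • w := by
  have hwpos : 0 < ‖w‖ := norm_pos_iff.2 hw
  refine ⟨⟨‖w‖⁻¹ • w, by simp [norm_smul, hwpos.ne']⟩, ?_, rfl⟩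
  rw [isSupporting_iff]
  simp only [real_inner_smul_left]
  obtain ⟨k, hk, e⟩ := h0
  exact ⟨⟨k, hk, by rw [e, mul_zero]⟩, fun k hk => mul_nonneg (inv_nonneg.2 hwpos.le) (h k hk)⟩

lemma IsWideBallBody.isCompact {K : Set (Sph d)} {r : ℝ} (hK : IsWideBallBody r K) :
    IsCompact K := by
  obtain ⟨X, -, -, -, rfl⟩ := hK
  exact (isClosed_ballInter X r).isCompact

lemma IsWideBallBody.nonempty {K : Set (Sph d)} {r : ℝ} (hK : IsWideBallBody r K) :
    K.Nonempty := by
  obtain ⟨X, hX, -, hd, rfl⟩ := hK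
  exact hX.mono (subset_ballInter hd)

lemma exists_inner_eq_zero (hd : 1 ≤ d) (u : Sph d) : ∃ e : Sph d, inner ℝ u.1 e.1 = 0 := by
  have hlt : Module.finrank ℝ (ℝ ∙ u.1) < Module.finrank ℝ (EuclideanSpace ℝ (Fin (d + 1))) := by
    rw [finrank_euclideanSpace_fin]
    exact (finrank_span_le_card ({u.1} : Set (EuclideanSpace ℝ (Fin (d + 1))))).trans_lt
      (by simp; omega)
  have hne : (ℝ ∙ u.1)ᗮ ≠ ⊥ := by
    intro h
    rw [Submodule.orthogonal_eq_bot_iff] at h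
    rw [h, finrank_top] at hlt
    exact lt_irrefl _ hlt
  obtain ⟨w, hw, hw0⟩ := Submodule.exists_mem_ne_zero_of_ne_bot hne
  refine ⟨⟨‖w‖⁻¹ • w, by simp [norm_smul, hw0]⟩, ?_⟩
  rw [real_inner_smul_right, Submodule.mem_orthogonal_singleton_iff_inner_right.1 hw, mul_zero]

/-- Every center of one of the balls is in the dual cone of the body. -/
lemma inner_nonneg_of_mem_ballInter {X : Set (Sph d)} {r : ℝ} (hr0 : 0 ≤ r)
    (hr : r ≤ Real.pi / 2) {u k : Sph d} (hu : u ∈ X) (hk : k ∈ ballInter X r) :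
    0 ≤ inner ℝ u.1 k.1 := by
  have hpi := Real.pi_pos
  exact (Real.cos_nonneg_of_neg_pi_div_two_le_of_le (by linarith) hr).trans
    ((mem_ballInter hr0 (by linarith)).1 hk u hu)

lemma IsWideBallBody.exists_isSupporting (hd : 1 ≤ d) {K : Set (Sph d)} {r : ℝ} (hr0 : 0 ≤ r)
    (hr : r ≤ Real.pi / 2) (hK : IsWideBallBody r K) : ∃ x, IsSupporting K x := by
  have hc := hK.isCompact
  have hne := hK.nonempty
  obtain ⟨X, ⟨u, hu⟩, -, hdi, rfl⟩ := hK
  obtain ⟨e, he⟩ := exists_inner_eq_zero hd u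
  by_cases h : ∀ k ∈ ballInter X r, 0 ≤ inner ℝ e.1 k.1
  · exact ⟨e, isSupporting_iff.2 ⟨⟨u, subset_ballInter hdi hu, by rw [real_inner_comm, he]⟩, h⟩⟩
  · push Not at h
    obtain ⟨t, -, ht1, h1, h2⟩ := exists_mem_segment_boundary hc hne
      (fun k hk => inner_nonneg_of_mem_ballInter hr0 hr hu hk) h
    have h0 : (1 - t) • u.1 + t • e.1 ≠ 0 := by
      intro h0
      have := congrArg (fun w => inner ℝ u.1 w) h0
      simp only [inner_add_right, real_inner_smul_right, he, inner_self_coe, inner_zero_right]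
        at this
      linarith
    obtain ⟨x, hx, -⟩ := exists_isSupporting_of_ne_zero h0 h1 h2
    exact ⟨x, hx⟩

/-- The dual cone of `K` omits `-x`. If it contains a unit vector `w ≠ x`, the segment from `w` to
`-x` leaves the cone at a point off the line of `x`. Otherwise `X = {x}`, and contact with the great
sphere forces `r = π/2`, so `K` is a hemisphere. -/
lemma IsWideBallBody.exists_isSupporting_ne {K : Set (Sph d)} {r : ℝ} (hr0 : 0 < r)
    (hr : r ≤ Real.pi / 2) (hK : IsWideBallBody r K) (hh : ∀ z, K ≠ hemisphere z) {x : Sph d}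
    (hx : IsSupporting K x) : ∃ y, IsSupporting K y ∧ y ≠ x := by
  have hpi := Real.pi_pos
  have hnx : ∃ k ∈ K, inner ℝ (-x.1) k.1 < 0 := by
    by_contra! h
    have hs : IsSupporting K (-x) := by
      obtain ⟨⟨k, hk, e⟩, -⟩ := isSupporting_iff.1 hx
      exact isSupporting_iff.2 ⟨⟨k, hk, by simp [e]⟩, h⟩
    have h1 := sdist_le_of_isSupporting hr0.le hr hK hx hs
    have h2 : sdist x (-x) = Real.pi := by simp [sdist_eq, inner_neg_right]
    linarith
  obtain ⟨w, hw, hwx⟩ : ∃ w : Sph d, (∀ k ∈ K, 0 ≤ inner ℝ w.1 k.1) ∧ w ≠ x := by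
    by_contra! hall
    obtain ⟨X, ⟨u, hu⟩, -, hdi, rfl⟩ := hK
    have hX : ∀ u ∈ X, u = x := fun u hu =>
      hall u fun k hk => inner_nonneg_of_mem_ballInter hr0.le hr hu hk
    obtain ⟨⟨k, hk, e⟩, -⟩ := isSupporting_iff.1 hx
    have h1 := (mem_ballInter hr0.le (by linarith)).1 hk u hu
    rw [hX u hu, e] at h1
    have hr2 : r = Real.pi / 2 := by
      by_contra hne
      have := Real.cos_pos_of_mem_Ioo ⟨by linarith, lt_of_le_of_ne hr hne⟩
      linarith
    apply hh x
    have : X = {x} := Set.eq_singleton_iff_unique_mem.2 ⟨hX u hu ▸ hu, hX⟩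
    rw [this, hr2, ballInter, Set.biInter_singleton, hemisphere]
  obtain ⟨t, ht0, ht1, h1, h2⟩ := exists_mem_segment_boundary hK.isCompact hK.nonempty hw hnx
  have hwx' : w ≠ -x := by
    rintro rfl
    obtain ⟨k, hk, e⟩ := hnx
    exact absurd (hw k hk) (not_le.2 (by simpa using e))
  have hpar : ∀ l : ℝ, (1 - t) • w.1 + t • -x.1 ≠ l • x.1 := by
    intro l hl
    have e : w.1 = ((1 - t)⁻¹ * (l + t)) • x.1 := by
      rw [mul_smul, add_smul, ← hl, smul_neg, neg_add_cancel_right, smul_smul,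
        inv_mul_cancel₀ (by linarith), one_smul]
    have en : |(1 - t)⁻¹ * (l + t)| = 1 := by
      have := congrArg norm e
      rwa [norm_smul, norm_coe, norm_coe, mul_one, Real.norm_eq_abs, eq_comm] at this
    rcases eq_or_eq_neg_of_abs_eq en with h | h
    · exact hwx (Subtype.ext (by rw [e, h, one_smul]))
    · exact hwx' (Subtype.ext (by rw [e, h]; simp))
  have h0 : (1 - t) • w.1 + t • -x.1 ≠ 0 := by simpa using hpar 0
  obtain ⟨y, hy, e⟩ := exists_isSupporting_of_ne_zero h0 h1 h2
  refine ⟨y, hy, ?_⟩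
  intro hyx
  have e' := (congrArg Subtype.val hyx).symm.trans e
  refine hpar ‖(1 - t) • w.1 + t • -x.1‖ (Eq.symm ?_)
  exact (congrArg _ e').trans (smul_inv_smul₀ (norm_ne_zero_iff.2 h0) _)

lemma formLune_of_isSupporting {K : Set (Sph d)} {r : ℝ} (hr0 : 0 < r)
    (hr : r ≤ Real.pi / 2) (hK : IsWideBallBody r K) {x y : Sph d} (hx : IsSupporting K x)
    (hy : IsSupporting K y) (hne : x ≠ y) : FormLune x y := by
  refine ⟨hne, ?_⟩
  rintro rfl
  have h1 := sdist_le_of_isSupporting hr0.le hr hK hx hy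
  have h2 : sdist (-y) y = Real.pi := by simp [sdist_eq]
  linarith

lemma sdist_eq_zero {x y : Sph d} (h : sdist x y = 0) : x = y :=
  eq_of_inner_eq_one (by rw [← cos_sdist, h, Real.cos_zero])

/-! ### Existence of the minima -/

lemma isLeast_widthAt {K : Set (Sph d)} {r : ℝ} (hr0 : 0 < r) (hr : r ≤ Real.pi / 2)
    (hK : IsWideBallBody r K) (hh : ∀ z, K ≠ hemisphere z) {x : Sph d} (hx : IsSupporting K x) :
    IsLeast (luneWidths K x) (widthAt K x) := by
  obtain ⟨y₀, hy₀, hne⟩ := hK.exists_isSupporting_ne hr0 hr hh hx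
  -- The narrowest lune comes from the farthest supporting center.
  obtain ⟨y, hy, hmax⟩ := (isCompact_setOf_isSupporting hK.isCompact).exists_isMaxOn ⟨y₀, hy₀⟩
    (f := fun y => sdist x y)
    (continuous_sdist_right x).continuousOn
  have hpos : x ≠ y := by
    rintro rfl
    have h1 : sdist x y₀ ≤ sdist x x := hmax hy₀
    rw [sdist_self] at h1
    exact hne (sdist_eq_zero (le_antisymm h1 (sdist_nonneg _ _))).symm
  have hl : IsLeast (luneWidths K x) (luneWidth x y) := by
    refine ⟨⟨y, hy, formLune_of_isSupporting hr0 hr hK hx hy hpos, rfl⟩, ?_⟩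
    rintro _ ⟨y', hy', hf, rfl⟩
    rw [luneWidth_eq hf, luneWidth_eq (formLune_of_isSupporting hr0 hr hK hx hy hpos)]
    have : sdist x y' ≤ sdist x y := hmax hy'
    linarith
  rwa [widthAt, hl.csInf_eq]

lemma isLeast_minWidth (hd : 1 ≤ d) {K : Set (Sph d)} {r : ℝ} (hr0 : 0 < r)
    (hr : r ≤ Real.pi / 2) (hK : IsWideBallBody r K) (hh : ∀ z, K ≠ hemisphere z) :
    IsLeast (widths K) (minWidth K) := by
  obtain ⟨x₀, hx₀⟩ := hK.exists_isSupporting hd hr0.le hr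
  have hc := isCompact_setOf_isSupporting hK.isCompact
  obtain ⟨⟨x, y⟩, hmem, hmax⟩ := (hc.prod hc).exists_isMaxOn
    ⟨(x₀, x₀), Set.mk_mem_prod hx₀ hx₀⟩ continuous_sdist.continuousOn
  obtain ⟨hx, hy⟩ : IsSupporting K x ∧ IsSupporting K y := Set.mem_prod.1 hmem
  have hle : ∀ x' y', IsSupporting K x' → IsSupporting K y' → sdist x' y' ≤ sdist x y :=
    fun x' y' hx' hy' => isMaxOn_iff.1 hmax (x', y') (Set.mk_mem_prod hx' hy')
  have hl : IsLeast (widths K) (widthAt K x) := by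
    refine ⟨⟨x, hx, rfl⟩, ?_⟩
    rintro _ ⟨x', hx', rfl⟩
    obtain ⟨y', hy', hf, e⟩ := (isLeast_widthAt hr0 hr hK hh hx').1
    have hxy : x ≠ y := by
      rintro rfl
      have h1 := hle x' y' hx' hy'
      rw [sdist_self] at h1
      exact hf.1 (sdist_eq_zero (le_antisymm h1 (sdist_nonneg _ _)))
    have hf' := formLune_of_isSupporting hr0 hr hK hx hy hxy
    refine ((isLeast_widthAt hr0 hr hK hh hx).2 ⟨y, hy, hf', rfl⟩).trans ?_
    rw [e, luneWidth_eq hf, luneWidth_eq hf']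
    linarith [hle x' y' hx' hy']
  rwa [minWidth, hl.csInf_eq]

lemma le_minWidth (hd : 1 ≤ d) {K : Set (Sph d)} {r : ℝ} (hr0 : 0 < r)
    (hr : r ≤ Real.pi / 2) (hK : IsWideBallBody r K) (hh : ∀ z, K ≠ hemisphere z) :
    r ≤ minWidth K := by
  obtain ⟨x, hx, e⟩ := (isLeast_minWidth hd hr0 hr hK hh).1
  obtain ⟨y, hy, hf, e'⟩ := (isLeast_widthAt hr0 hr hK hh hx).1
  rw [e, e', luneWidth_eq hf]
  linarith [sdist_le_of_isSupporting hr0.le hr hK hx hy]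

/-! ### The regular simplex and its body -/

lemma exists_isRegularSimplex (d : ℕ) {r : ℝ} (hr0 : 0 ≤ r) (hr : r ≤ Real.pi / 2) :
    ∃ v : Fin (d + 1) → Sph d, IsRegularSimplex r v := by
  have hpi := Real.pi_pos
  have hc0 : 0 ≤ Real.cos r := Real.cos_nonneg_of_neg_pi_div_two_le_of_le (by linarith) hr
  have hc1 := Real.cos_le_one r
  set c := Real.cos r with hc
  set α := √(1 - c) with hα
  have hα2 : α ^ 2 = 1 - c := Real.sq_sqrt (by linarith)
  set n : ℝ := (d : ℝ) + 1 with hn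
  have hnpos : 0 < n := by positivity
  -- The vertices are `α` times the basis vectors plus `β` in every coordinate; `β` is the root of
  -- `n * β ^ 2 + 2 * α * β = c` making the off-diagonal Gram entries `c`.
  set β := (√(α ^ 2 + n * c) - α) / n with hβ
  have hβ2 : 2 * α * β + n * β ^ 2 = c := by
    have h1 : n * β + α = √(α ^ 2 + n * c) := by rw [hβ]; field_simp; ring
    have h2 : (n * β + α) ^ 2 = α ^ 2 + n * c := by rw [h1, Real.sq_sqrt (by positivity)]
    have h3 : n * (2 * α * β + n * β ^ 2) = n * c := by linarith [h2]
    exact mul_left_cancel₀ hnpos.ne' h3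
  let f : Fin (d + 1) → EuclideanSpace ℝ (Fin (d + 1)) := fun i =>
    WithLp.toLp 2 fun l => (if l = i then α else 0) + β
  have hf : ∀ i j, inner ℝ (f i) (f j) = (if i = j then α ^ 2 else 0) + c := by
    intro i j
    have : ∀ l, ((if l = j then α else 0) + β) * ((if l = i then α else 0) + β) =
        (if l = i then (if l = j then α ^ 2 else 0) else 0) + (if l = i then α * β else 0) +
          (if l = j then α * β else 0) + β ^ 2 := by
      intro l; split_ifs <;> ring
    simp only [f, PiLp.inner_apply, RCLike.inner_apply, conj_trivial, this,
      Finset.sum_add_distrib, Finset.sum_ite_eq', Finset.mem_univ, if_true, Finset.sum_const,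
      Finset.card_univ, Fintype.card_fin, nsmul_eq_mul]
    push_cast
    rw [← hn]
    linarith
  refine ⟨fun i => ⟨f i, ?_⟩, fun i j hij => ?_⟩
  · rw [mem_sphere_zero_iff_norm, ← sq_eq_sq₀ (norm_nonneg _) zero_le_one,
      ← real_inner_self_eq_norm_sq, hf, if_pos rfl, hα2]
    ring
  · rw [sdist_eq_iff hr0 (by linarith)]
    change inner ℝ (f i) (f j) = _
    rw [hf, if_neg hij, zero_add]

lemma IsRegularSimplex.isWideBallBody {r : ℝ} (hr0 : 0 ≤ r) {v : Fin (d + 1) → Sph d}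
    (hv : IsRegularSimplex r v) : IsWideBallBody r (ballInter (Set.range v) r) := by
  refine ⟨_, Set.range_nonempty v, (Set.finite_range v).isClosed, ?_, rfl⟩
  refine csSup_le ⟨_, v 0, ⟨0, rfl⟩, v 0, ⟨0, rfl⟩, rfl⟩ ?_
  rintro _ ⟨_, ⟨i, rfl⟩, _, ⟨j, rfl⟩, rfl⟩
  rcases eq_or_ne i j with rfl | h
  · rwa [sdist_self]
  · exact (hv i j h).le

/-- The hemisphere whose boundary touches the ball of center `v i` at a second vertex `v j`
supports the body. -/
lemma IsRegularSimplex.exists_isSupporting {r : ℝ} (hr0 : 0 < r) (hr : r ≤ Real.pi / 2)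
    {v : Fin (d + 1) → Sph d} (hv : IsRegularSimplex r v) {i j : Fin (d + 1)} (hij : i ≠ j) :
    ∃ x, IsSupporting (ballInter (Set.range v) r) x ∧
      x.1 = (Real.sin r)⁻¹ • ((v i).1 - Real.cos r • (v j).1) := by
  have hpi := Real.pi_pos
  have hs := Real.sin_pos_of_pos_of_lt_pi hr0 (by linarith)
  have hcs := Real.sin_sq_add_cos_sq r
  have hc0 : 0 ≤ Real.cos r := Real.cos_nonneg_of_neg_pi_div_two_le_of_le (by linarith) hr
  have hi : ∀ i j, i ≠ j → inner ℝ (v i).1 (v j).1 = Real.cos r := fun i j h =>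
    (sdist_eq_iff hr0.le (by linarith)).1 (hv i j h)
  have hmem : ∀ y, y ∈ ballInter (Set.range v) r ↔ ∀ i, Real.cos r ≤ inner ℝ (v i).1 y.1 := by
    intro y; rw [mem_ballInter hr0.le (by linarith), Set.forall_mem_range]
  refine ⟨⟨(Real.sin r)⁻¹ • ((v i).1 - Real.cos r • (v j).1), ?_⟩, ?_, rfl⟩
  · rw [mem_sphere_zero_iff_norm, ← sq_eq_sq₀ (norm_nonneg _) zero_le_one,
      ← real_inner_self_eq_norm_sq]
    simp only [inner_sub_left, inner_sub_right, real_inner_smul_left, real_inner_smul_right,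
      inner_self_coe, hi i j hij, hi j i hij.symm]
    field_simp
    linarith
  · rw [isSupporting_iff]
    simp only [inner_sub_left, real_inner_smul_left]
    refine ⟨⟨v j, (hmem _).2 fun l => ?_, ?_⟩, fun k hk => ?_⟩
    · rcases eq_or_ne l j with rfl | h
      · rw [inner_self_coe]; exact Real.cos_le_one r
      · exact (hi l j h).ge
    · rw [hi i j hij, inner_self_coe]; ring
    · refine mul_nonneg (inv_nonneg.2 hs.le) ?_
      have h1 := (hmem k).1 hk i
      have h2 := mul_le_mul_of_nonneg_left (inner_le_one (v j) k) hc0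
      linarith

lemma eq_of_hemisphere_subset {x z : Sph d} (h : hemisphere z ⊆ hemisphere x) : x = z := by
  have h0 : 0 ≤ inner ℝ x.1 z.1 := mem_hemisphere.1 (h (mem_hemisphere.2 (by simp)))
  set a : ℝ := inner ℝ x.1 z.1 with ha
  have hzx : inner ℝ z.1 x.1 = a := real_inner_comm _ _
  have ha1 : a ≤ 1 := inner_le_one x z
  -- Up to scale, the point of the great sphere of `z` deepest on the far side of `x`; its
  -- membership in `hemisphere x` forces `a ^ 2 = 1`.
  set w := a • z.1 - x.1 with hw
  have hxw : inner ℝ x.1 w = a * a - 1 := by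
    rw [hw, inner_sub_right, real_inner_smul_right, inner_self_coe]
  have hzw : inner ℝ z.1 w = 0 := by
    rw [hw, inner_sub_right, real_inner_smul_right, inner_self_coe, hzx]; ring
  have h1 : 0 ≤ a * a - 1 := by
    rcases eq_or_ne w 0 with hw0 | hw0
    · rw [← hxw, hw0, inner_zero_right]
    · have hpos : 0 < ‖w‖ := norm_pos_iff.2 hw0
      have hk := mem_hemisphere.1 (@h ⟨‖w‖⁻¹ • w, by simp [norm_smul, hpos.ne']⟩
        (mem_hemisphere.2 (by simp only [real_inner_smul_right, hzw, mul_zero, le_refl])))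
      simp only [real_inner_smul_right, hxw] at hk
      exact nonneg_of_mul_nonneg_right hk (inv_pos.2 hpos)
  exact eq_of_inner_eq_one (le_antisymm ha1 (by nlinarith))

/-- The hemisphere around each vertex contains the body, so a body equal to `hemisphere z` would
make every vertex equal to `z`. -/
lemma IsRegularSimplex.ne_hemisphere (hd : 1 ≤ d) {r : ℝ} (hr0 : 0 < r) (hr : r ≤ Real.pi / 2)
    {v : Fin (d + 1) → Sph d} (hv : IsRegularSimplex r v) (z : Sph d) :
    ballInter (Set.range v) r ≠ hemisphere z := by
  intro h
  have hpi := Real.pi_pos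
  have hv' : ∀ i, v i = z := fun i => eq_of_hemisphere_subset fun k hk =>
    mem_hemisphere.2 (inner_nonneg_of_mem_ballInter hr0.le hr (Set.mem_range_self i) (h ▸ hk))
  have h01 : (0 : Fin (d + 1)) ≠ Fin.last d := by
    rw [Ne, Fin.ext_iff]; simp; omega
  have := hv 0 (Fin.last d) h01
  rw [hv', hv', sdist_self] at this
  exact hr0.ne this

lemma IsRegularSimplex.minWidth_eq (hd : 1 ≤ d) {r : ℝ} (hr0 : 0 < r) (hr : r ≤ Real.pi / 2)
    {v : Fin (d + 1) → Sph d} (hv : IsRegularSimplex r v) :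
    minWidth (ballInter (Set.range v) r) = r := by
  have hpi := Real.pi_pos
  have hK := hv.isWideBallBody hr0.le
  have hh := hv.ne_hemisphere hd hr0 hr
  have hs := Real.sin_pos_of_pos_of_lt_pi hr0 (by linarith)
  have hcs := Real.sin_sq_add_cos_sq r
  have h01 : (0 : Fin (d + 1)) ≠ Fin.last d := by
    rw [Ne, Fin.ext_iff]; simp; omega
  have hi : ∀ i j, i ≠ j → inner ℝ (v i).1 (v j).1 = Real.cos r := fun i j h =>
    (sdist_eq_iff hr0.le (by linarith)).1 (hv i j h)
  obtain ⟨x, hx, ex⟩ := hv.exists_isSupporting hr0 hr h01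
  obtain ⟨y, hy, ey⟩ := hv.exists_isSupporting hr0 hr h01.symm
  have hxy : inner ℝ x.1 y.1 = Real.cos (Real.pi - r) := by
    rw [ex, ey, Real.cos_pi_sub]
    simp only [inner_sub_left, inner_sub_right, real_inner_smul_left, real_inner_smul_right,
      inner_self_coe, hi _ _ h01, hi _ _ h01.symm]
    field_simp
    linear_combination Real.cos r * hcs
  have hdist : sdist x y = Real.pi - r := (sdist_eq_iff (by linarith) (by linarith)).2 hxy
  have hf : FormLune x y := by
    refine formLune_of_isSupporting hr0 hr hK hx hy ?_
    rintro rfl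
    rw [sdist_self] at hdist
    linarith
  refine le_antisymm ?_ (le_minWidth hd hr0 hr hK hh)
  refine ((isLeast_minWidth hd hr0 hr hK hh).2 ⟨x, hx, rfl⟩).trans ?_
  refine ((isLeast_widthAt hr0 hr hK hh hx).2 ⟨y, hy, hf, rfl⟩).trans ?_
  rw [luneWidth_eq hf, hdist]
  linarith

end SphericalWidth

open SphericalWidth
theorem proposition3 (d : ℕ) (hd : 2 ≤ d) (r : ℝ) (hr0 : 0 < r) (hr : r ≤ Real.pi / 2) :
    (∃ v : Fin (d + 1) → Sph d, IsRegularSimplex r v) ∧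
    (∀ K : Set (Sph d), IsWideBallBody r K → (∀ z : Sph d, K ≠ hemisphere z) →
      (∀ x : Sph d, IsSupporting K x → IsLeast (luneWidths K x) (widthAt K x)) ∧
      IsLeast (widths K) (minWidth K)) ∧
    (∀ v : Fin (d + 1) → Sph d, IsRegularSimplex r v →
      IsWideBallBody r (ballInter (Set.range v) r) ∧
      (∀ z : Sph d, ballInter (Set.range v) r ≠ hemisphere z) ∧
      minWidth (ballInter (Set.range v) r) = r ∧
      ∀ K : Set (Sph d), IsWideBallBody r K → (∀ z : Sph d, K ≠ hemisphere z) →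
        minWidth (ballInter (Set.range v) r) ≤ minWidth K) := by
  have hd1 : 1 ≤ d := by omega
  refine ⟨exists_isRegularSimplex d hr0.le hr, fun K hK hh =>
    ⟨fun x hx => isLeast_widthAt hr0 hr hK hh hx, isLeast_minWidth hd1 hr0 hr hK hh⟩,
    fun v hv => ⟨hv.isWideBallBody hr0.le, hv.ne_hemisphere hd1 hr0 hr,
      hv.minWidth_eq hd1 hr0 hr, fun K hK hh => ?_⟩⟩
  rw [hv.minWidth_eq hd1 hr0 hr]
  exact le_minWidth hd1 hr0 hr hK hh
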